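/- Let $E$ be a nonempty finite set, $X_+=E^{\mathbb Z_+}$, $X_-=E^{-\mathbb N}$ (sequences indexed by the negative integers), $X=E^{\mathbb Z}=X_-\times X_+$, with the product topologies and Borel $\sigma$-algebras. Let $S$ denote the left shift, $(Sx)_j=x_{j+1}$, on $X_+$ and on $X$, and for $\phi:X_+\to\mathbb R$ put $S_n\phi=\sum_{k=0}^{n-1}\phi\circ S^k$. A specification on $E^{\mathbb L}$ ($\mathbb L$ countable) is a family of measurable probability densities $\gamma_\Lambda(\xi_\Lambda|\eta_{\Lambda^c})$, $\Lambda\Subset\mathbb L$ finite, whose kernels $\gamma_\Lambda f(\eta)=\sum_{\xi\in E^\Lambda}\gamma_\Lambda(\xi_\Lambda|\eta_{\Lambda^c})f(\xi_\Lambda\eta_{\Lambda^c})$ satisfy $\gamma_\Lambda\gamma_\Delta=\gamma_\Lambda$ for $\Delta\subset\Lambda$. It is quasilocal if each $\gamma_\Lambda(\xi_\Lambda|\eta_{\Lambda^c})$ is continuous in $\eta$, non-null if $\inf_{\xi,\eta}\gamma_\Lambda(\xi_\Lambda|\eta_{\Lambda^c})>0$ for every $\Lambda$, and (for $\mathbb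 L=\mathbb Z$) translation-invariant if $\gamma_{\Lambda+k}(B|\omega)=\gamma_\Lambda(S^kB|S^k\omega)$ for all Borel $B$, all $\Lambda$, $k\in\mathbb Z$ and $\omega$. A probability measure $\mu$ is Gibbs for $\gamma$ if $\int\gamma_\Lambda f\,d\mu=\int f\,d\mu$ for all $f\in L^1(\mu)$ and all finite $\Lambda$. Let $\phi:X_+\to\mathbb R$ be continuous and satisfy the extensibility condition: for all $a,b\in E$ the functions $x\mapsto S_{n+1}\phi(x_{-n}^{-1}\,b\,x_1^\infty)-S_{n+1}\phi(x_{-n}^{-1}\,a\,x_1^\infty)$ converge uniformly in $x\in X$ as $n\to\infty$. Let $\nu$ be a Gibbs probability measure on $X_+$ for the half-line densities $$\overset{\rightharpoonup}{\gamma}^\phi_\Lambda(a_\Lambda|x_{\Lambda^c})=\frac{\exp\bigl(S_{n+1}\phi(a_\Lambda x_{\Lambda^c})\bigr)}{\sum_{\bar a_\Lambda}\exp\bigl(S_{n+1}\phi(\bar a_\Lambda x_{\Lambda^c})\bigr)},\qquad n=\max\Lambda,\ \Lambda\Subset\mathbb Z_+ .$$ Let $\rho$ be the uniform Bernoulli measure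 on $X_-$ and $\mu_0=\rho\times\nu$, a probability measure on $X$. Then there is a unique translation-invariant quasilocal non-null specification $\overset{\rightleftharpoons}{\gamma}^\phi$ on $X$ with single-site densities $$\overset{\rightleftharpoons}{\gamma}^\phi_{\{i\}}(\sigma_i|\omega_{\{i\}^c})=\lim_{p\to\infty}\frac{\exp\bigl(S_{i+p+1}\phi(\omega_{-p}^{i-1}\sigma_i\omega_{i+1}^\infty)\bigr)}{\sum_{a\in E}\exp\bigl(S_{i+p+1}\phi(\omega_{-p}^{i-1}a\,\omega_{i+1}^\infty)\bigr)}\qquad(i\in\mathbb Z),$$ and every weak$^*$ limit point $\mu$ of the sequence of probability measures $\tilde\mu_n=\frac1n\sum_{i=0}^{n-1}\mu_0\circ S^{-i}$, $n\ge1$, is a translation-invariant ($\mu\circ S^{-1}=\mu$) Gibbs measure for $\overset{\rightleftharpoons}{\gamma}^\phi$. -/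

import Mathlib

open MeasureTheory Filter Topology

namespace HalfLine

noncomputable section

section LatticeSystems

variable {L E : Type*} [DecidableEq L] [Fintype E]

/-- The concatenation `ξ_Λ η_{Λᶜ}`. -/
def glue (Λ : Finset L) (ξ : Λ → E) (η : L → E) : L → E :=
  fun i => if h : i ∈ Λ then ξ ⟨i, h⟩ else η i

/-- A family of densities `γ_Λ(σ_Λ | σ_{Λᶜ})`, indexed by the finite volumes `Λ` and written as
functions of the full configuration `σ`. Thus `γ_Λ(ξ_Λ | η_{Λᶜ})` is `γ Λ (glue Λ ξ η)`. -/
abbrev DensityFamily (L E : Type*) := Finset L → (L → E) → ℝ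

/-- The action of the kernel on functions,
`γ_Λ f (η) = ∑_{ξ ∈ E^Λ} γ_Λ(ξ_Λ | η_{Λᶜ}) f(ξ_Λ η_{Λᶜ})`. -/
def act (γ : DensityFamily L E) (Λ : Finset L) (f : (L → E) → ℝ) (η : L → E) : ℝ :=
  ∑ ξ : Λ → E, γ Λ (glue Λ ξ η) * f (glue Λ ξ η)

/-- The kernel itself, `γ_Λ(B | η)`. -/
def kernelProb (γ : DensityFamily L E) (Λ : Finset L) (B : Set (L → E)) (η : L → E) : ℝ :=
  act γ Λ (B.indicator 1) η

/-- A specification: a consistent family of (proper) probability kernels. As `E` is finite, such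
kernels are the same as measurable densities. Consistency is `γ_Λ γ_Δ = γ_Λ` for `Δ ⊆ Λ`. -/
structure IsSpecification [MeasurableSpace E] (γ : DensityFamily L E) : Prop where
  measurable : ∀ Λ : Finset L, Measurable (γ Λ)
  nonneg : ∀ (Λ : Finset L) (σ : L → E), 0 ≤ γ Λ σ
  sum_eq_one : ∀ (Λ : Finset L) (η : L → E), ∑ ξ : Λ → E, γ Λ (glue Λ ξ η) = 1
  consistent : ∀ Δ Λ : Finset L, Δ ⊆ Λ → ∀ (f : (L → E) → ℝ) (η : L → E),
    act γ Λ (act γ Δ f) η = act γ Λ f η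

/-- Quasilocality: every `γ_Λ(ξ_Λ | η)` is continuous in the boundary condition `η`. -/
def IsQuasilocal [TopologicalSpace E] (γ : DensityFamily L E) : Prop :=
  ∀ (Λ : Finset L) (ξ : Λ → E), Continuous fun η : L → E => γ Λ (glue Λ ξ η)

/-- Non-nullness: `inf_{ω, η} γ_Λ(ω_Λ | η_{Λᶜ}) > 0` for every finite `Λ`. -/
def IsNonNull (γ : DensityFamily L E) : Prop :=
  ∀ Λ : Finset L, ∃ c : ℝ, 0 < c ∧ ∀ (ξ : Λ → E) (η : L → E), c ≤ γ Λ (glue Λ ξ η)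

/-- The DLR equations: `∫ γ_Λ f dμ = ∫ f dμ` for all `f ∈ L¹(μ)` and all finite `Λ`. -/
def IsGibbs [MeasurableSpace E] (γ : DensityFamily L E) (μ : Measure (L → E)) : Prop :=
  ∀ (Λ : Finset L) (f : (L → E) → ℝ), Integrable f μ →
    Integrable (act γ Λ f) μ ∧ ∫ σ, act γ Λ f σ ∂μ = ∫ σ, f σ ∂μ

end LatticeSystems

section HalfAndWholeLine

variable {E : Type*}

/-- The left shift `S` on `X₊ = E^ℕ`. -/
def leftShift (x : ℕ → E) : ℕ → E := fun k => x (k + 1)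

/-- The Birkhoff sum `S_n φ (x) = ∑_{k<n} φ (S^k x)`. -/
def ergodicSum (φ : (ℕ → E) → ℝ) (n : ℕ) (x : ℕ → E) : ℝ := birkhoffSum leftShift φ n x

/-- The `k`-th power `S^k` (with `k ∈ ℤ`) of the left shift on `X = E^ℤ`. -/
def shift (k : ℤ) (x : ℤ → E) : ℤ → E := fun j => x (j + k)

/-- The half-line configuration `x_m^∞` seen from the site `m`. -/
def tail (m : ℤ) (x : ℤ → E) : ℕ → E := fun k => x (m + k)

/-- The densities of the half-line specification of the potential `φ`:
`exp (S_{n+1} φ (a_Λ x_{Λᶜ})) / ∑_{ā_Λ} exp (S_{n+1} φ (ā_Λ x_{Λᶜ}))` with `n = max Λ`. -/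
def halfLineDensity [Fintype E] (φ : (ℕ → E) → ℝ) : DensityFamily ℕ E := fun Λ x =>
  Real.exp (ergodicSum φ (Λ.sup id + 1) x) /
    ∑ a : Λ → E, Real.exp (ergodicSum φ (Λ.sup id + 1) (glue Λ a x))

/-- The extensibility condition: for all `a, b ∈ E`, the functions
`x ↦ S_{n+1} φ (x_{-n}^{-1} b x_1^∞) - S_{n+1} φ (x_{-n}^{-1} a x_1^∞)` converge uniformly on
`E^ℤ` as `n → ∞`. -/
def Extensible (φ : (ℕ → E) → ℝ) : Prop :=
  ∀ a b : E, ∃ F : (ℤ → E) → ℝ,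
    TendstoUniformly
      (fun (n : ℕ) (x : ℤ → E) =>
        ergodicSum φ (n + 1) (tail (-(n : ℤ)) (Function.update x 0 b)) -
          ergodicSum φ (n + 1) (tail (-(n : ℤ)) (Function.update x 0 a)))
      F atTop

/-- `exp (S_{i+p+1} φ (ω_{-p}^{i-1} ω_i ω_{i+1}^∞)) /
∑_a exp (S_{i+p+1} φ (ω_{-p}^{i-1} a ω_{i+1}^∞))` (meaningful for `p ≥ -i`). -/
def singleSiteApprox [Fintype E] (φ : (ℕ → E) → ℝ) (i : ℤ) (p : ℕ) (ω : ℤ → E) : ℝ :=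
  Real.exp (ergodicSum φ (i + p + 1).toNat (tail (-(p : ℤ)) ω)) /
    ∑ a : E, Real.exp
      (ergodicSum φ (i + p + 1).toNat (tail (-(p : ℤ)) (Function.update ω i a)))

/-- Translation-invariance: `γ_{Λ+k}(B | ω) = γ_Λ(S^k B | S^k ω)`. -/
def IsTranslationInvariant [Fintype E] [MeasurableSpace E] (γ : DensityFamily ℤ E) : Prop :=
  ∀ (B : Set (ℤ → E)), MeasurableSet B → ∀ (Λ : Finset ℤ) (k : ℤ) (ω : ℤ → E),
    kernelProb γ (Λ.image fun i => i + k) B ω = kernelProb γ Λ (shift k '' B) (shift k ω)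

/-- `γ` is a translation-invariant quasilocal non-null specification on `E^ℤ` whose single-site
densities are the limits, as `p → ∞`, of the half-line single-site densities. -/
structure IsWholeLineSpecification [Fintype E] [TopologicalSpace E] [MeasurableSpace E]
    (φ : (ℕ → E) → ℝ) (γ : DensityFamily ℤ E) : Prop where
  isSpecification : IsSpecification γ
  translationInvariant : IsTranslationInvariant γ
  quasilocal : IsQuasilocal γ
  nonNull : IsNonNull γ
  singleSite : ∀ (i : ℤ) (ω : ℤ → E),
    Tendsto (fun p : ℕ => singleSiteApprox φ i p ω) atTop (𝓝 (γ {i} ω))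

/-- The identification of `X₋ × X₊` with `X = E^ℤ`, where `X₋` is indexed by the negative
integers. -/
def joinLines (u : ({j : ℤ // j < 0} → E) × (ℕ → E)) : ℤ → E :=
  fun j => if h : j < 0 then u.1 ⟨j, h⟩ else u.2 j.toNat

variable [MeasurableSpace E]

lemma measurable_joinLines : Measurable (joinLines (E := E)) := by
  refine measurable_pi_lambda _ fun j => ?_
  by_cases h : j < 0
  · simp only [joinLines, h, dif_pos]
    exact (measurable_pi_apply _).comp measurable_fst
  · simp only [joinLines, h, dif_neg, not_false_eq_true]
    exact (measurable_pi_apply _).comp measurable_snd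

lemma measurable_shift (k : ℤ) : Measurable (shift (E := E) k) :=
  measurable_pi_lambda _ fun j => measurable_pi_apply (j + k)

/-- The uniform Bernoulli measure on `X₋`. -/
def uniformBernoulli (E : Type*) [Fintype E] [Nonempty E] [MeasurableSpace E] :
    Measure ({j : ℤ // j < 0} → E) :=
  Measure.infinitePi fun _ => (PMF.uniformOfFintype E).toMeasure

instance (E : Type*) [Fintype E] [Nonempty E] [MeasurableSpace E] :
    IsProbabilityMeasure (uniformBernoulli E) := by
  unfold uniformBernoulli; infer_instance

/-- `μ₀ = ρ × ν` on `X = X₋ × X₊`, with `ρ` the uniform Bernoulli measure on `X₋`. -/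
def initialMeasure [Fintype E] [Nonempty E] (ν : Measure (ℕ → E)) : Measure (ℤ → E) :=
  ((uniformBernoulli E).prod ν).map joinLines

instance [Fintype E] [Nonempty E] (ν : Measure (ℕ → E)) [IsProbabilityMeasure ν] :
    IsProbabilityMeasure (initialMeasure ν) :=
  Measure.isProbabilityMeasure_map measurable_joinLines.aemeasurable

/-- The averages of the shifted measures. To avoid division by zero, the `n`-th term is the
average over `n + 1` shifts, `(1 / (n + 1)) ∑_{i=0}^{n} μ₀ ∘ S^{-i}`. -/
def cesaroAverage (μ₀ : Measure (ℤ → E)) [IsProbabilityMeasure μ₀] (n : ℕ) :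
    ProbabilityMeasure (ℤ → E) :=
  ⟨((n + 1 : ℕ) : ENNReal)⁻¹ • ∑ i ∈ Finset.range (n + 1), μ₀.map (shift (i : ℤ)), by
    constructor
    have h : ∀ i : ℕ, (μ₀.map (shift (i : ℤ))) Set.univ = 1 := fun i => by
      rw [Measure.map_apply (measurable_shift _) MeasurableSet.univ]
      simp
    simp only [Measure.smul_apply, Measure.finsetSum_apply, h, Finset.sum_const,
      Finset.card_range, smul_eq_mul, nsmul_eq_mul, mul_one]
    exact ENNReal.inv_mul_cancel (by simp) (by simp)⟩

end HalfAndWholeLine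

end

end HalfLine

/-! Only energy differences between configurations agreeing off a finite set matter. A window `[-p,
p]` collects such a difference by summing `φ` along the orbit. Sites to the right of the last
disagreement contribute nothing, so extensibility, moved from the origin by shifts and applied one
site at a time, makes the window energies converge uniformly (`windowEnergy_cauchy`). The limit is
an additive, shift-covariant cocycle. The Boltzmann densities of any cocycle satisfy consistency by
detailed balance (`boltzmann_isSpecification`), and uniform convergence makes the limiting densities
continuous. A positive specification is determined by its single-site densities, whence uniqueness.

For the Gibbs property, look at `μ₀` from a site `i`: the window `[-i, i]` is then the stretch `[0,
2i]` of the half line, where its densities are exactly those of the half-line specification. With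
the left half frozen, the DLR equations of `ν` therefore give exact DLR equations for the window
densities under `μ₀ ∘ S^{-i}` (`integral_act_windowDensity`). Replacing window densities by limiting
ones costs an error vanishing as `i → ∞`. Cesàro averaging preserves this, and continuity of the
densities lets it pass to weak limit points. Invariance follows by telescoping. -/

namespace HalfLine

noncomputable section

/-! ### Energy differences and their limit under extensibility -/

section Energy

variable {E : Type*}

/-- The energy difference between `σ'` and `σ` collected by the sites in `[m, M]`. -/
def energyDiff (φ : (ℕ → E) → ℝ) (m M : ℤ) (σ σ' : ℤ → E) : ℝ :=
  ∑ j ∈ Finset.Icc m M, (φ (tail j σ') - φ (tail j σ))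

lemma leftShift_iterate_tail (k : ℕ) (m : ℤ) (x : ℤ → E) :
    leftShift^[k] (tail m x) = tail (m + k) x := by
  induction k with
  | zero => simp
  | succ k ih =>
    rw [Function.iterate_succ_apply', ih]
    funext l
    simp only [leftShift, tail]
    congr 1
    push_cast
    ring

lemma ergodicSum_tail (φ : (ℕ → E) → ℝ) (n : ℕ) (m : ℤ) (x : ℤ → E) :
    ergodicSum φ (n + 1) (tail m x) = ∑ j ∈ Finset.Icc m (m + n), φ (tail j x) := by
  simp only [ergodicSum, birkhoffSum, leftShift_iterate_tail]
  refine Finset.sum_bij (fun k _ => m + (k : ℤ)) ?_ ?_ ?_ ?_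
  · intro k hk
    simp only [Finset.mem_range, Finset.mem_Icc] at hk ⊢
    omega
  · intro a _ b _ h
    simpa using h
  · intro j hj
    simp only [Finset.mem_Icc] at hj
    exact ⟨(j - m).toNat, by simp only [Finset.mem_range]; omega, by omega⟩
  · intro k _
    rfl

lemma ergodicSum_sub (φ : (ℕ → E) → ℝ) (n : ℕ) (m : ℤ) (σ σ' : ℤ → E) :
    ergodicSum φ (n + 1) (tail m σ') - ergodicSum φ (n + 1) (tail m σ) =
      energyDiff φ m (m + n) σ σ' := by
  simp only [ergodicSum_tail, energyDiff, Finset.sum_sub_distrib]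

lemma energyDiff_self (φ : (ℕ → E) → ℝ) (m M : ℤ) (σ : ℤ → E) :
    energyDiff φ m M σ σ = 0 := by
  simp [energyDiff]

lemma energyDiff_add (φ : (ℕ → E) → ℝ) (m M : ℤ) (σ σ' σ'' : ℤ → E) :
    energyDiff φ m M σ σ' + energyDiff φ m M σ' σ'' = energyDiff φ m M σ σ'' := by
  simp only [energyDiff, ← Finset.sum_add_distrib]
  exact Finset.sum_congr rfl fun j _ => by ring

/-- Sites to the right of all disagreements do not contribute. -/
lemma energyDiff_eq_of_le (φ : (ℕ → E) → ℝ) (m : ℤ) {K M : ℤ} (hKM : K ≤ M) {σ σ' : ℤ → E}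
    (h : ∀ j, K < j → σ j = σ' j) : energyDiff φ m M σ σ' = energyDiff φ m K σ σ' := by
  symm
  refine Finset.sum_subset (Finset.Icc_subset_Icc le_rfl hKM) fun j hj hj' => ?_
  have : tail j σ' = tail j σ := by
    funext k
    simp only [Finset.mem_Icc] at hj hj'
    exact (h _ (by omega)).symm
  rw [this, sub_self]

lemma tail_shift (j k : ℤ) (σ : ℤ → E) : tail j (shift k σ) = tail (j + k) σ := by
  funext l
  simp only [tail, shift]
  congr 1
  ring

lemma energyDiff_shift (φ : (ℕ → E) → ℝ) (m M k : ℤ) (σ σ' : ℤ → E) :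
    energyDiff φ m M (shift k σ) (shift k σ') = energyDiff φ (m + k) (M + k) σ σ' := by
  simp only [energyDiff, tail_shift]
  rw [← Finset.map_add_right_Icc m M k, Finset.sum_map]
  rfl

lemma continuous_tail [TopologicalSpace E] (j : ℤ) : Continuous (tail (E := E) j) :=
  continuous_pi fun k => continuous_apply (j + k)

lemma continuous_shift [TopologicalSpace E] (k : ℤ) : Continuous (shift (E := E) k) :=
  continuous_pi fun j => continuous_apply (j + k)

/-- The energy difference collected by the window `[-p, p]`. -/
abbrev windowEnergy (φ : (ℕ → E) → ℝ) (p : ℕ) (σ σ' : ℤ → E) : ℝ :=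
  energyDiff φ (-(p : ℤ)) p σ σ'

/-- For large windows, the window may be centred at any other site. -/
lemma windowEnergy_shift_eq (φ : (ℕ → E) → ℝ) {σ σ' : ℤ → E} {K k : ℤ} {p q : ℕ}
    (h : ∀ j, K < j → σ j = σ' j) (hp : K ≤ p) (hq : (q : ℤ) = p + k) (hK : K - k ≤ q) :
    windowEnergy φ q (shift k σ) (shift k σ') = windowEnergy φ p σ σ' := by
  rw [windowEnergy, energyDiff_shift, energyDiff_eq_of_le φ _ (by omega) h,
    windowEnergy, energyDiff_eq_of_le φ _ hp h]
  congr 1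
  omega

/-- Seen from `i`, and cut to the right of `i`, the window `[-p, p]` becomes `[-(p+i), 0]`, which is
the sum in the extensibility condition. Finiteness of `E` makes the rate uniform in the two spins.
-/
lemma windowEnergy_cauchy_singleton [Finite E] {φ : (ℕ → E) → ℝ} (hext : Extensible φ) (i : ℤ)
    {ε : ℝ} (hε : 0 < ε) : ∃ N : ℕ, ∀ p ≥ N, ∀ q ≥ N, ∀ σ σ' : ℤ → E,
      (∀ j, j ≠ i → σ j = σ' j) → |windowEnergy φ p σ σ' - windowEnergy φ q σ σ'| < ε := by
  choose F hF using hext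
  have key : ∀ᶠ n : ℕ in atTop, ∀ a b : E, ∀ x : ℤ → E,
      dist (F a b x) (ergodicSum φ (n + 1) (tail (-(n : ℤ)) (Function.update x 0 b)) -
          ergodicSum φ (n + 1) (tail (-(n : ℤ)) (Function.update x 0 a))) < ε / 2 :=
    eventually_all.2 fun a => eventually_all.2 fun b =>
      Metric.tendstoUniformly_iff.1 (hF a b) _ (half_pos hε)
  obtain ⟨N, hN⟩ := eventually_atTop.1 key
  have main : ∀ p ≥ N + i.natAbs, ∀ σ σ' : ℤ → E, (∀ j, j ≠ i → σ j = σ' j) →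
      dist (F (σ i) (σ' i) (shift i σ)) (windowEnergy φ p σ σ') < ε / 2 := by
    intro p hp σ σ' h
    have hq : N ≤ (p + i).toNat := by omega
    have e1 : Function.update (shift i σ) 0 (σ i) = shift i σ := by
      funext j
      by_cases hj : j = 0
      · subst hj; simp [shift]
      · simp [hj]
    have e2 : Function.update (shift i σ) 0 (σ' i) = shift i σ' := by
      funext j
      by_cases hj : j = 0
      · subst hj; simp [shift]
      · simp only [ne_eq, hj, not_false_eq_true, Function.update_of_ne, shift]
        exact h _ (by omega)
    have := hN _ hq (σ i) (σ' i) (shift i σ)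
    rw [e1, e2, ergodicSum_sub] at this
    have hag : ∀ j, i < j → σ j = σ' j := fun j hj => h j (by omega)
    rwa [energyDiff_shift, neg_add_cancel, zero_add,
      show -(((p + i).toNat : ℕ) : ℤ) + i = -(p : ℤ) by omega,
      ← energyDiff_eq_of_le φ _ (show i ≤ (p : ℤ) by omega) hag] at this
  refine ⟨N + i.natAbs, fun p hp q hq σ σ' h => ?_⟩
  have h1 := main p hp σ σ' h
  have h2 := main q hq σ σ' h
  rw [Real.dist_eq] at h1 h2
  rw [abs_lt] at *
  constructor <;> linarith

lemma windowEnergy_cauchy [Finite E] {φ : (ℕ → E) → ℝ} (hext : Extensible φ) (Λ : Finset ℤ) :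
    ∀ ε : ℝ, 0 < ε → ∃ N : ℕ, ∀ p ≥ N, ∀ q ≥ N, ∀ σ σ' : ℤ → E,
      (∀ j, j ∉ Λ → σ j = σ' j) → |windowEnergy φ p σ σ' - windowEnergy φ q σ σ'| < ε := by
  induction Λ using Finset.induction_on with
  | empty =>
    refine fun ε hε => ⟨0, fun p _ q _ σ σ' h => ?_⟩
    obtain rfl : σ = σ' := funext fun j => h j (by simp)
    simpa [windowEnergy, energyDiff_self] using hε
  | insert i Λ _ ih =>
    intro ε hε
    obtain ⟨N, hN⟩ := ih (ε / 2) (half_pos hε)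
    obtain ⟨N', hN'⟩ := windowEnergy_cauchy_singleton hext i (half_pos hε)
    refine ⟨max N N', fun p hp q hq σ σ'' h => ?_⟩
    -- An intermediate configuration: the change from `σ` to `σ'` happens inside `Λ`, that from `σ'`
    -- to `σ''` only at `i`.
    set σ' := Function.update σ'' i (σ i) with hσ'
    have h1 := hN p (le_of_max_le_left hp) q (le_of_max_le_left hq) σ σ' (fun j hj => by
      by_cases hji : j = i
      · subst hji; simp [hσ']
      · rw [hσ', Function.update_of_ne hji]
        exact h j (by simp [hji, hj]))
    have h2 := hN' p (le_of_max_le_right hp) q (le_of_max_le_right hq) σ' σ'' (fun j hj => by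
      rw [hσ', Function.update_of_ne hj])
    simp only [windowEnergy] at *
    rw [← energyDiff_add φ _ _ σ σ' σ'', ← energyDiff_add φ _ _ σ σ' σ'']
    rw [abs_lt] at *
    constructor <;> linarith

/-- The energy difference of two configurations which agree off a finite set. -/
def energyLimit (φ : (ℕ → E) → ℝ) (σ σ' : ℤ → E) : ℝ :=
  limUnder atTop fun p : ℕ => windowEnergy φ p σ σ'

lemma tendsto_windowEnergy [Finite E] {φ : (ℕ → E) → ℝ} (hext : Extensible φ) {Λ : Finset ℤ}
    {σ σ' : ℤ → E} (h : ∀ j, j ∉ Λ → σ j = σ' j) :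
    Tendsto (fun p : ℕ => windowEnergy φ p σ σ') atTop (𝓝 (energyLimit φ σ σ')) := by
  refine CauchySeq.tendsto_limUnder (Metric.cauchySeq_iff.2 fun ε hε => ?_)
  obtain ⟨N, hN⟩ := windowEnergy_cauchy hext Λ ε hε
  exact ⟨N, fun p hp q hq => hN p hp q hq σ σ' h⟩

lemma windowEnergy_uniform [Finite E] {φ : (ℕ → E) → ℝ} (hext : Extensible φ) (Λ : Finset ℤ)
    {ε : ℝ} (hε : 0 < ε) : ∃ N : ℕ, ∀ p ≥ N, ∀ σ σ' : ℤ → E,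
      (∀ j, j ∉ Λ → σ j = σ' j) → |windowEnergy φ p σ σ' - energyLimit φ σ σ'| ≤ ε := by
  obtain ⟨N, hN⟩ := windowEnergy_cauchy hext Λ ε hε
  refine ⟨N, fun p hp σ σ' h => ?_⟩
  refine le_of_tendsto ((tendsto_const_nhds.sub (tendsto_windowEnergy hext h)).abs) ?_
  filter_upwards [eventually_ge_atTop N] with q hq
  exact (hN p hp q hq σ σ' h).le

lemma energyLimit_self (φ : (ℕ → E) → ℝ) (σ : ℤ → E) : energyLimit φ σ σ = 0 := by
  simp only [energyLimit, windowEnergy, energyDiff_self]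
  exact tendsto_const_nhds.limUnder_eq

lemma energyLimit_add [Finite E] {φ : (ℕ → E) → ℝ} (hext : Extensible φ) {Λ : Finset ℤ}
    {σ σ' σ'' : ℤ → E} (h : ∀ j, j ∉ Λ → σ j = σ' j) (h' : ∀ j, j ∉ Λ → σ' j = σ'' j) :
    energyLimit φ σ σ' + energyLimit φ σ' σ'' = energyLimit φ σ σ'' := by
  have := (tendsto_windowEnergy hext h).add (tendsto_windowEnergy hext h')
  simp only [windowEnergy, energyDiff_add] at this
  exact tendsto_nhds_unique this
    (tendsto_windowEnergy hext fun j hj => (h j hj).trans (h' j hj))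

lemma exists_forall_lt_of_agree_off {Λ : Finset ℤ} {σ σ' : ℤ → E}
    (h : ∀ j, j ∉ Λ → σ j = σ' j) : ∃ K : ℤ, ∀ j, K < j → σ j = σ' j := by
  obtain ⟨K, hK⟩ := Λ.bddAbove
  exact ⟨K, fun j hj => h j fun hm => absurd (hK hm) (not_le.2 hj)⟩

/-- Shifting only recentres the window. Its right end is immaterial once past all disagreements, and
its left end still tends to `-∞`. -/
lemma energyLimit_shift [Finite E] {φ : (ℕ → E) → ℝ} (hext : Extensible φ) {Λ : Finset ℤ} (k : ℤ)
    {σ σ' : ℤ → E} (h : ∀ j, j ∉ Λ → σ j = σ' j) :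
    energyLimit φ (shift k σ) (shift k σ') = energyLimit φ σ σ' := by
  obtain ⟨K, hK⟩ := exists_forall_lt_of_agree_off h
  have h' : ∀ j, j ∉ Λ.image (fun i => i - k) → shift k σ j = shift k σ' j := fun j hj =>
    h _ fun hm => hj (Finset.mem_image.2 ⟨_, hm, by ring⟩)
  have ht : Tendsto (fun p : ℕ => ((p : ℤ) + k).toNat) atTop atTop :=
    tendsto_atTop.2 fun b => (eventually_ge_atTop (b + k.natAbs)).mono fun p hp => by omega
  refine tendsto_nhds_unique ((tendsto_windowEnergy hext h').comp ht) ?_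
  refine (tendsto_windowEnergy hext h).congr' ?_
  filter_upwards [eventually_ge_atTop (K.natAbs + 2 * k.natAbs)] with p hp
  exact (windowEnergy_shift_eq (q := ((p : ℤ) + k).toNat) φ hK (by omega) (by omega)
    (by omega)).symm

end Energy

/-! ### Combinatorics of concatenation and resampling -/

section Glue

variable {L E : Type*} [DecidableEq L]

lemma glue_of_notMem {Λ : Finset L} (ξ : Λ → E) (η : L → E) {j : L} (hj : j ∉ Λ) :
    glue Λ ξ η j = η j := by
  simp [glue, hj]

lemma glue_of_mem {Λ : Finset L} (ξ : Λ → E) (η : L → E) {j : L} (hj : j ∈ Λ) :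
    glue Λ ξ η j = ξ ⟨j, hj⟩ := by
  simp [glue, hj]

lemma glue_restrict (Λ : Finset L) (σ : L → E) : glue Λ (fun l => σ l) σ = σ := by
  funext j
  simp [glue]

lemma glue_congr {Λ : Finset L} (ξ : Λ → E) {σ σ' : L → E} (h : ∀ j, j ∉ Λ → σ j = σ' j) :
    glue Λ ξ σ = glue Λ ξ σ' := by
  funext j
  by_cases hj : j ∈ Λ
  · simp [glue, hj]
  · simp [glue, hj, h j hj]

lemma glue_singleton (i : L) (ξ : ({i} : Finset L) → E) (σ : L → E) :
    glue {i} ξ σ = Function.update σ i (ξ ⟨i, Finset.mem_singleton_self i⟩) := by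
  funext j
  by_cases hj : j = i
  · subst hj; simp [glue]
  · simp [glue, hj]

lemma sum_glue_singleton [Fintype E] (i : L) (σ : L → E) (G : (L → E) → ℝ) :
    ∑ ξ : ({i} : Finset L) → E, G (glue {i} ξ σ) = ∑ a : E, G (Function.update σ i a) := by
  simp only [glue_singleton]
  refine Fintype.sum_bijective (fun ξ : ({i} : Finset L) → E => ξ ⟨i, Finset.mem_singleton_self i⟩)
    ⟨fun ξ ξ' h => ?_, fun a => ⟨fun _ => a, rfl⟩⟩ _ _ fun _ => rfl
  funext ⟨l, hl⟩
  obtain rfl := Finset.mem_singleton.1 hl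
  exact h

/-- Resampling in `Δ ⊆ Λ` is reversible with respect to the counting measure on `E^Λ`. -/
lemma sum_glue_symm [Fintype E] {Δ Λ : Finset L} (hΔ : Δ ⊆ Λ) (K : (L → E) → (L → E) → ℝ)
    (η : L → E) :
    ∑ ξ : Λ → E, ∑ ζ : Δ → E, K (glue Λ ξ η) (glue Δ ζ (glue Λ ξ η)) =
      ∑ ξ : Λ → E, ∑ ζ : Δ → E, K (glue Δ ζ (glue Λ ξ η)) (glue Λ ξ η) := by
  rw [← Fintype.sum_prod_type', ← Fintype.sum_prod_type']
  -- `T` writes `ζ` into `ξ` on `Δ` and stores the overwritten spins as the new `ζ`, so applying it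
  -- twice undoes the exchange.
  let T : (Λ → E) × (Δ → E) → (Λ → E) × (Δ → E) := fun q =>
    (fun l => if h : (l : L) ∈ Δ then q.2 ⟨l, h⟩ else q.1 l, fun l => q.1 ⟨l, hΔ l.2⟩)
  have hT : Function.Involutive T := by
    rintro ⟨ξ, ζ⟩
    refine Prod.ext (funext fun l => ?_) (funext fun l => ?_)
    · by_cases h : (l : L) ∈ Δ <;> simp [T, h]
    · simp [T]
  have h1 : ∀ q : (Λ → E) × (Δ → E), glue Λ (T q).1 η = glue Δ q.2 (glue Λ q.1 η) := by
    rintro ⟨ξ, ζ⟩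
    funext j
    by_cases h : j ∈ Δ
    · simp [T, glue, h, hΔ h]
    · by_cases h' : j ∈ Λ <;> simp [T, glue, h, h']
  have h2 : ∀ q : (Λ → E) × (Δ → E),
      glue Δ (T q).2 (glue Λ (T q).1 η) = glue Λ q.1 η := by
    intro q
    rw [← h1, hT]
  refine Fintype.sum_bijective T hT.bijective _ _ fun q => ?_
  rw [h2, h1]

lemma sum_image_reindex [Fintype E] {L' : Type*} [DecidableEq L'] {e : L → L'}
    (he : Function.Injective e) (Λ : Finset L) (G : (Λ → E) → ℝ) :
    ∑ ξ : ↥(Λ.image e) → E, G (fun l => ξ ⟨e l, Finset.mem_image_of_mem e l.2⟩) =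
      ∑ ξ : Λ → E, G ξ := by
  let e' : Λ → ↥(Λ.image e) := fun l => ⟨e l, Finset.mem_image_of_mem e l.2⟩
  have he' : Function.Bijective e' := by
    refine ⟨fun a b h => Subtype.ext (he (congrArg Subtype.val h)), fun ⟨l', hl'⟩ => ?_⟩
    obtain ⟨l, hl, rfl⟩ := Finset.mem_image.1 hl'
    exact ⟨⟨l, hl⟩, rfl⟩
  exact Fintype.sum_equiv ((Equiv.ofBijective e' he').symm.arrowCongr (Equiv.refl E)) _ _
    fun ξ => rfl

lemma glue_image_comp {L' : Type*} [DecidableEq L'] {e : L → L'} (he : Function.Injective e)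
    (Λ : Finset L) (ξ : ↥(Λ.image e) → E) (η : L' → E) :
    (fun l => glue (Λ.image e) ξ η (e l)) =
      glue Λ (fun l => ξ ⟨e l, Finset.mem_image_of_mem e l.2⟩) (fun l => η (e l)) := by
  funext l
  have : e l ∈ Λ.image e ↔ l ∈ Λ := by simp [he.eq_iff]
  by_cases h : l ∈ Λ
  · rw [glue_of_mem _ _ h, glue_of_mem _ _ (this.2 h)]
  · rw [glue_of_notMem _ _ h, glue_of_notMem _ _ (fun h' => h (this.1 h'))]

lemma continuous_glue [TopologicalSpace E] (Λ : Finset L) (ξ : Λ → E) :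
    Continuous (glue Λ ξ : (L → E) → L → E) := by
  refine continuous_pi fun j => ?_
  by_cases h : j ∈ Λ
  · simpa only [glue, h, dif_pos] using continuous_const
  · simpa only [glue, h, dif_neg, not_false_eq_true] using continuous_apply j

lemma IsNonNull.pos {γ : DensityFamily L E} (h : IsNonNull γ)
    (Λ : Finset L) (σ : L → E) : 0 < γ Λ σ := by
  obtain ⟨c, hc, hle⟩ := h Λ
  have := hle (fun l => σ l) σ
  rw [glue_restrict] at this
  exact hc.trans_le this

end Glue

/-! ### Specifications built from cocycles, and determination by single sites -/

section Boltzmann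

variable {L E : Type*} [DecidableEq L] [Fintype E]

/-- The Boltzmann densities of a function `A σ σ'` playing the role of the (negative) energy
difference between `σ'` and `σ`. -/
def boltzmann (A : (L → E) → (L → E) → ℝ) : DensityFamily L E := fun Λ σ =>
  (∑ ξ : Λ → E, Real.exp (A σ (glue Λ ξ σ)))⁻¹

/-- `A` is additive along configurations which differ at finitely many sites. -/
structure IsCocycle (A : (L → E) → (L → E) → ℝ) : Prop where
  self : ∀ σ, A σ σ = 0
  add : ∀ (Λ : Finset L) (σ σ' σ'' : L → E), (∀ j, j ∉ Λ → σ j = σ' j) →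
    (∀ j, j ∉ Λ → σ' j = σ'' j) → A σ σ' + A σ' σ'' = A σ σ''

lemma one_le_partition {A : (L → E) → (L → E) → ℝ} (hA : ∀ σ, A σ σ = 0) (Λ : Finset L)
    (σ : L → E) : 1 ≤ ∑ ξ : Λ → E, Real.exp (A σ (glue Λ ξ σ)) := by
  have := Finset.single_le_sum (f := fun ξ : Λ → E => Real.exp (A σ (glue Λ ξ σ)))
    (fun _ _ => (Real.exp_pos _).le) (Finset.mem_univ fun l : Λ => σ l)
  simpa [glue_restrict, hA] using this

lemma boltzmann_pos {A : (L → E) → (L → E) → ℝ} (hA : ∀ σ, A σ σ = 0) (Λ : Finset L)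
    (σ : L → E) : 0 < boltzmann A Λ σ :=
  inv_pos.2 (one_pos.trans_le (one_le_partition hA Λ σ))

lemma boltzmann_le_one {A : (L → E) → (L → E) → ℝ} (hA : ∀ σ, A σ σ = 0) (Λ : Finset L)
    (σ : L → E) : boltzmann A Λ σ ≤ 1 :=
  inv_le_one_of_one_le₀ (one_le_partition hA Λ σ)

lemma boltzmann_mul_sum {A : (L → E) → (L → E) → ℝ} (hA : ∀ σ, A σ σ = 0) (Λ : Finset L)
    (σ : L → E) : boltzmann A Λ σ * ∑ ξ : Λ → E, Real.exp (A σ (glue Λ ξ σ)) = 1 :=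
  inv_mul_cancel₀ (one_pos.trans_le (one_le_partition hA Λ σ)).ne'

lemma boltzmann_of_agree {A : (L → E) → (L → E) → ℝ} (hA : IsCocycle A) {Λ : Finset L}
    {σ σ' : L → E} (h : ∀ j, j ∉ Λ → σ j = σ' j) :
    boltzmann A Λ σ' = boltzmann A Λ σ * Real.exp (A σ σ') := by
  have key : ∑ ξ : Λ → E, Real.exp (A σ (glue Λ ξ σ)) =
      Real.exp (A σ σ') * ∑ ξ : Λ → E, Real.exp (A σ' (glue Λ ξ σ')) := by
    rw [Finset.mul_sum]
    refine Finset.sum_congr rfl fun ξ _ => ?_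
    rw [← Real.exp_add, glue_congr ξ h,
      hA.add Λ σ σ' _ h fun j hj => (glue_of_notMem ξ σ' hj).symm]
  have h1 := boltzmann_mul_sum hA.self Λ σ
  have h2 := boltzmann_mul_sum hA.self Λ σ'
  rw [key] at h1
  calc boltzmann A Λ σ' = (boltzmann A Λ σ * (Real.exp (A σ σ') *
        ∑ ξ : Λ → E, Real.exp (A σ' (glue Λ ξ σ')))) * boltzmann A Λ σ' := by rw [h1, one_mul]
    _ = boltzmann A Λ σ * Real.exp (A σ σ') * (boltzmann A Λ σ' *
        ∑ ξ : Λ → E, Real.exp (A σ' (glue Λ ξ σ'))) := by ring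
    _ = _ := by rw [h2, mul_one]

/-- Resampling `Δ` multiplies the `Λ`-density by the exponential of the energy change, so the sum
over `ζ` produces exactly the partition function of `Δ`. -/
lemma sum_boltzmann_glue {A : (L → E) → (L → E) → ℝ} (hA : IsCocycle A) {Δ Λ : Finset L}
    (hΔ : Δ ⊆ Λ) (σ : L → E) :
    boltzmann A Δ σ * ∑ ζ : Δ → E, boltzmann A Λ (glue Δ ζ σ) = boltzmann A Λ σ := by
  have : ∀ ζ : Δ → E, boltzmann A Λ (glue Δ ζ σ) =
      boltzmann A Λ σ * Real.exp (A σ (glue Δ ζ σ)) := fun ζ =>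
    boltzmann_of_agree hA fun j hj => (glue_of_notMem ζ σ fun h => hj (hΔ h)).symm
  simp only [this, ← Finset.mul_sum]
  rw [mul_left_comm, boltzmann_mul_sum hA.self, mul_one]

lemma boltzmann_isSpecification [MeasurableSpace E] {A : (L → E) → (L → E) → ℝ}
    (hA : IsCocycle A) (hm : ∀ Λ, Measurable (boltzmann A Λ)) :
    IsSpecification (boltzmann A) where
  measurable := hm
  nonneg Λ σ := (boltzmann_pos hA.self Λ σ).le
  sum_eq_one Λ η := by
    have : ∀ ξ : Λ → E, boltzmann A Λ (glue Λ ξ η) =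
        boltzmann A Λ η * Real.exp (A η (glue Λ ξ η)) := fun ξ =>
      boltzmann_of_agree hA fun j hj => (glue_of_notMem ξ η hj).symm
    simp only [this, ← Finset.mul_sum, boltzmann_mul_sum hA.self]
  consistent Δ Λ hΔ f η := by
    simp only [act, Finset.mul_sum]
    rw [sum_glue_symm hΔ
      (fun σ σ' => boltzmann A Λ σ * (boltzmann A Δ σ' * f σ'))]
    refine Finset.sum_congr rfl fun ξ _ => ?_
    rw [← Finset.sum_mul]
    conv_rhs => rw [← sum_boltzmann_glue hA hΔ]
    ring

/-- In a specification, the densities of a volume are determined, up to resampling in `Δ`, by the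
densities of the smaller volume `Δ`. -/
lemma IsSpecification.density_eq [MeasurableSpace E] {γ : DensityFamily L E}
    (hγ : IsSpecification γ) {Δ Λ : Finset L} (hΔ : Δ ⊆ Λ) (σ : L → E) :
    γ Λ σ = γ Δ σ * ∑ ζ : Δ → E, γ Λ (glue Δ ζ σ) := by
  classical
  -- Test consistency on the indicator of the single configuration `σ`; after exchanging the roles
  -- of the two configurations, one term in `ξ` survives.
  have h := hγ.consistent Δ Λ hΔ (fun τ => if τ = σ then 1 else 0) σ
  simp only [act, Finset.mul_sum] at h
  rw [sum_glue_symm hΔ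
    (fun τ τ' => γ Λ τ * (γ Δ τ' * if τ' = σ then 1 else 0))] at h
  have hinj : ∀ ξ : Λ → E, glue Λ ξ σ = σ ↔ ξ = fun l : Λ => σ l := by
    intro ξ
    constructor
    · intro hξ
      funext l
      rw [← congrFun hξ l, glue_of_mem _ _ l.2]
    · rintro rfl
      exact glue_restrict Λ σ
  simp only [hinj] at h
  rw [Fintype.sum_eq_single (fun l : Λ => σ l), Fintype.sum_eq_single (fun l : Λ => σ l)] at h
  · simp only [if_true, glue_restrict, mul_one] at h
    rw [← h, ← Finset.sum_mul, mul_comm]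
  · intro ξ hξ
    simp [hξ]
  · intro ξ hξ
    simp [hξ]

/-- A positive specification is determined by its single-site densities. -/
lemma IsSpecification.eq_of_singleton_eq [MeasurableSpace E] {γ γ' : DensityFamily L E}
    (hγ : IsSpecification γ) (hγ' : IsSpecification γ') (hpos : ∀ Λ σ, 0 < γ Λ σ)
    (h : ∀ i σ, γ' {i} σ = γ {i} σ) : γ' = γ := by
  -- By `density_eq` both `Λ`-densities contain the same single-site factor. It cancels in the
  -- quotient, and what remains does not see the spin at `i`.
  have step : ∀ (Λ : Finset L) (i : L), i ∈ Λ → ∀ σ σ' : L → E, (∀ j, j ≠ i → σ j = σ' j) →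
      γ' Λ σ / γ Λ σ = γ' Λ σ' / γ Λ σ' := by
    intro Λ i hi σ σ' hσ
    have hs : ({i} : Finset L) ⊆ Λ := Finset.singleton_subset_iff.2 hi
    have hg : ∀ ζ : ({i} : Finset L) → E, glue {i} ζ σ = glue {i} ζ σ' := fun ζ =>
      glue_congr ζ fun j hj => hσ j (by simpa using hj)
    rw [hγ'.density_eq hs σ, hγ.density_eq hs σ, hγ'.density_eq hs σ', hγ.density_eq hs σ', h, h,
      mul_div_mul_left _ _ (hpos _ _).ne', mul_div_mul_left _ _ (hpos _ _).ne']
    simp only [hg]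
  have const : ∀ Λ Δ : Finset L, Δ ⊆ Λ → ∀ σ σ' : L → E, (∀ j, j ∉ Δ → σ j = σ' j) →
      γ' Λ σ / γ Λ σ = γ' Λ σ' / γ Λ σ' := by
    intro Λ Δ
    induction Δ using Finset.induction_on with
    | empty =>
      intro _ σ σ' hσ
      rw [show σ = σ' from funext fun j => hσ j (by simp)]
    | insert i Δ _ ih =>
      intro hΔ σ σ'' hσ
      rw [ih ((Finset.subset_insert i Δ).trans hΔ) σ (Function.update σ'' i (σ i)) fun j hj => by
        by_cases hji : j = i
        · subst hji; simp
        · rw [Function.update_of_ne hji]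
          exact hσ j (by simp [hji, hj])]
      exact step Λ i (hΔ (Finset.mem_insert_self i Δ)) _ _ fun j hj => by
        rw [Function.update_of_ne hj]
  funext Λ σ
  have hr : ∀ ξ : Λ → E, γ' Λ (glue Λ ξ σ) = γ' Λ σ / γ Λ σ * γ Λ (glue Λ ξ σ) := by
    intro ξ
    rw [const Λ Λ subset_rfl σ (glue Λ ξ σ) fun j hj => (glue_of_notMem ξ σ hj).symm,
      div_mul_cancel₀ _ (hpos _ _).ne']
  -- The ratio is constant on the configurations with a given exterior, so normalisation forces it
  -- to be 1.
  have h1 := hγ'.sum_eq_one Λ σ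
  simp only [hr, ← Finset.mul_sum, hγ.sum_eq_one, mul_one] at h1
  exact (div_eq_one_iff_eq (hpos _ _).ne').1 h1

/-- An energy error `ε` changes the partition function by a factor of at most `exp ε`; since
densities are at most 1, this multiplicative bound becomes an additive one. -/
lemma abs_boltzmann_sub_le {A B : (L → E) → (L → E) → ℝ} (hA : ∀ σ, A σ σ = 0)
    (hB : ∀ σ, B σ σ = 0) (Λ : Finset L) (σ : L → E) {ε : ℝ}
    (h : ∀ ξ : Λ → E, |A σ (glue Λ ξ σ) - B σ (glue Λ ξ σ)| ≤ ε) :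
    |boltzmann A Λ σ - boltzmann B Λ σ| ≤ Real.exp ε - 1 := by
  have main : ∀ A B : (L → E) → (L → E) → ℝ, (∀ σ, A σ σ = 0) → (∀ σ, B σ σ = 0) →
      (∀ ξ : Λ → E, |A σ (glue Λ ξ σ) - B σ (glue Λ ξ σ)| ≤ ε) →
      boltzmann A Λ σ - boltzmann B Λ σ ≤ Real.exp ε - 1 := by
    intro A B hA hB h
    have hle : ∑ ξ : Λ → E, Real.exp (B σ (glue Λ ξ σ)) ≤
        Real.exp ε * ∑ ξ : Λ → E, Real.exp (A σ (glue Λ ξ σ)) := by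
      rw [Finset.mul_sum]
      refine Finset.sum_le_sum fun ξ _ => ?_
      rw [← Real.exp_add, Real.exp_le_exp]
      linarith [(abs_le.1 (h ξ)).1]
    have hε : 0 ≤ ε := (abs_nonneg _).trans (h fun l => σ l)
    have h1 := boltzmann_mul_sum hA Λ σ
    have h2 := boltzmann_mul_sum hB Λ σ
    have hAB : boltzmann A Λ σ ≤ Real.exp ε * boltzmann B Λ σ := by
      have hp := (mul_pos (boltzmann_pos hA Λ σ) (boltzmann_pos hB Λ σ)).le
      calc boltzmann A Λ σ = boltzmann A Λ σ * (boltzmann B Λ σ *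
            ∑ ξ : Λ → E, Real.exp (B σ (glue Λ ξ σ))) := by rw [h2, mul_one]
        _ = boltzmann A Λ σ * boltzmann B Λ σ *
            ∑ ξ : Λ → E, Real.exp (B σ (glue Λ ξ σ)) := by ring
        _ ≤ boltzmann A Λ σ * boltzmann B Λ σ *
            (Real.exp ε * ∑ ξ : Λ → E, Real.exp (A σ (glue Λ ξ σ))) :=
          mul_le_mul_of_nonneg_left hle hp
        _ = Real.exp ε * boltzmann B Λ σ * (boltzmann A Λ σ *
            ∑ ξ : Λ → E, Real.exp (A σ (glue Λ ξ σ))) := by ring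
        _ = _ := by rw [h1, mul_one]
    have h3 := boltzmann_le_one hB Λ σ
    nlinarith [Real.one_le_exp hε]
  refine abs_le.2 ⟨?_, main A B hA hB h⟩
  have := main B A hB hA fun ξ => by rw [abs_sub_comm]; exact h ξ
  linarith

lemma continuous_boltzmann [TopologicalSpace E] {A : (L → E) → (L → E) → ℝ} (hA : ∀ σ, A σ σ = 0)
    {Λ : Finset L}
    (h : ∀ ξ : Λ → E, Continuous fun σ => A σ (glue Λ ξ σ)) : Continuous (boltzmann A Λ) :=
  (continuous_finsetSum _ fun ξ _ => Real.continuous_exp.comp (h ξ)).inv₀ fun σ =>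
    (one_pos.trans_le (one_le_partition hA Λ σ)).ne'

end Boltzmann

/-! ### The whole-line specification -/

section WholeLine

variable {E : Type*}

lemma shift_injective (k : ℤ) : Function.Injective (shift (E := E) k) := by
  intro x y h
  funext j
  have := congrFun h (j - k)
  simpa [shift] using this

lemma continuous_energyDiff [TopologicalSpace E] {φ : (ℕ → E) → ℝ} (hφ : Continuous φ) (m M : ℤ)
    {Λ : Finset ℤ}
    (ξ : Λ → E) : Continuous fun σ : ℤ → E => energyDiff φ m M σ (glue Λ ξ σ) :=
  continuous_finsetSum _ fun j _ =>
    (hφ.comp ((continuous_tail j).comp (continuous_glue Λ ξ))).sub (hφ.comp (continuous_tail j))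

variable [Fintype E]

/-- The whole-line densities of an extensible potential. -/
def wholeLineDensity (φ : (ℕ → E) → ℝ) : DensityFamily ℤ E := boltzmann (energyLimit φ)

/-- The approximation of `wholeLineDensity` which only takes the sites in `[-p, p]` into
account. -/
def windowDensity (φ : (ℕ → E) → ℝ) (p : ℕ) : DensityFamily ℤ E := boltzmann (windowEnergy φ p)

lemma isCocycle_energyLimit {φ : (ℕ → E) → ℝ} (hext : Extensible φ) :
    IsCocycle (energyLimit φ) :=
  ⟨energyLimit_self φ, fun _ _ _ _ h h' => energyLimit_add hext h h'⟩

lemma windowDensity_uniform {φ : (ℕ → E) → ℝ} (hext : Extensible φ) (Λ : Finset ℤ) {ε : ℝ}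
    (hε : 0 < ε) : ∃ N : ℕ, ∀ p ≥ N, ∀ σ : ℤ → E,
      |windowDensity φ p Λ σ - wholeLineDensity φ Λ σ| ≤ ε := by
  -- Chosen so that `exp δ - 1 = ε`.
  have hδ : 0 < Real.log (1 + ε) := Real.log_pos (by linarith)
  obtain ⟨N, hN⟩ := windowEnergy_uniform hext Λ hδ
  refine ⟨N, fun p hp σ => ?_⟩
  have := abs_boltzmann_sub_le (fun σ => energyDiff_self φ _ _ σ) (energyLimit_self φ) Λ σ
    (ε := Real.log (1 + ε)) fun ξ => hN p hp σ _ fun j hj => (glue_of_notMem ξ σ hj).symm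
  rwa [Real.exp_log (by linarith), add_sub_cancel_left] at this

lemma wholeLineDensity_image {φ : (ℕ → E) → ℝ} (hext : Extensible φ) (Λ : Finset ℤ) (k : ℤ)
    (σ : ℤ → E) :
    wholeLineDensity φ (Λ.image fun i => i + k) σ = wholeLineDensity φ Λ (shift k σ) := by
  rw [wholeLineDensity, boltzmann, boltzmann, ← sum_image_reindex (add_left_injective k) Λ]
  congr 1
  refine Finset.sum_congr rfl fun ξ _ => ?_
  have := glue_image_comp (add_left_injective k) Λ ξ σ
  change _ = Real.exp (energyLimit φ (shift k σ)
    (glue Λ (fun l => ξ ⟨l + k, _⟩) (fun l => σ (l + k))))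
  rw [← this]
  exact congrArg Real.exp
    (energyLimit_shift hext k fun j hj => (glue_of_notMem ξ σ hj).symm).symm

lemma wholeLineDensity_translationInvariant [MeasurableSpace E] {φ : (ℕ → E) → ℝ}
    (hext : Extensible φ) : IsTranslationInvariant (wholeLineDensity φ) := by
  intro B _ Λ k ω
  rw [kernelProb, kernelProb, act, act, ← sum_image_reindex (add_left_injective k) Λ]
  refine Finset.sum_congr rfl fun ξ _ => ?_
  have hg : glue Λ (fun l => ξ ⟨(l : ℤ) + k, Finset.mem_image_of_mem _ l.2⟩) (shift k ω) =
      shift k (glue (Λ.image fun i => i + k) ξ ω) :=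
    (glue_image_comp (add_left_injective k) Λ ξ ω).symm
  rw [hg, wholeLineDensity_image hext]
  congr 1
  classical
  simp only [Set.indicator, (shift_injective k).mem_set_image, Pi.one_apply]

/-- Dividing through by the numerator turns the approximation into an inverse partition function of
window energies. -/
lemma tendsto_singleSiteApprox {φ : (ℕ → E) → ℝ} (hext : Extensible φ) (i : ℤ) (ω : ℤ → E) :
    Tendsto (fun p : ℕ => singleSiteApprox φ i p ω) atTop (𝓝 (wholeLineDensity φ {i} ω)) := by
  have h : ∀ a : E, ∀ j, j ∉ ({i} : Finset ℤ) → ω j = Function.update ω i a j := fun a j hj => by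
    rw [Function.update_of_ne (by simpa using hj)]
  have hlim : wholeLineDensity φ {i} ω =
      (∑ a : E, Real.exp (energyLimit φ ω (Function.update ω i a)))⁻¹ := by
    rw [wholeLineDensity, boltzmann, sum_glue_singleton i ω fun σ => Real.exp (energyLimit φ ω σ)]
  have hne : (∑ a : E, Real.exp (energyLimit φ ω (Function.update ω i a))) ≠ 0 := by
    rw [← sum_glue_singleton i ω fun σ => Real.exp (energyLimit φ ω σ)]
    exact (one_pos.trans_le (one_le_partition (energyLimit_self φ) {i} ω)).ne'
  rw [hlim]
  refine Tendsto.congr' ?_ ((tendsto_finsetSum Finset.univ fun a _ =>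
    (Real.continuous_exp.tendsto _).comp (tendsto_windowEnergy hext (h a))).inv₀ hne)
  -- For `p ≥ |i|` the `toNat` does not truncate and `i` lies in the window.
  filter_upwards [eventually_ge_atTop i.natAbs] with p hp
  have key : ∀ a : E, windowEnergy φ p ω (Function.update ω i a) =
      ergodicSum φ (i + p + 1).toNat (tail (-(p : ℤ)) (Function.update ω i a)) -
        ergodicSum φ (i + p + 1).toNat (tail (-(p : ℤ)) ω) := by
    intro a
    rw [show (i + p + 1).toNat = (i + p).toNat + 1 by omega, ergodicSum_sub, windowEnergy,
      energyDiff_eq_of_le φ _ (show i ≤ (p : ℤ) by omega)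
        (fun j hj => h a j (by simp; omega)),
      show -(p : ℤ) + ((i + p).toNat : ℤ) = i by omega]
  simp only [Function.comp_apply, key, Real.exp_sub, ← Finset.sum_div, inv_div, singleSiteApprox]

variable [TopologicalSpace E]

lemma continuous_windowDensity {φ : (ℕ → E) → ℝ} (hφ : Continuous φ) (p : ℕ) (Λ : Finset ℤ) :
    Continuous (windowDensity φ p Λ) :=
  continuous_boltzmann (fun σ => energyDiff_self φ _ _ σ) fun ξ => continuous_energyDiff hφ _ _ ξ

lemma continuous_wholeLineDensity {φ : (ℕ → E) → ℝ} (hφ : Continuous φ) (hext : Extensible φ)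
    (Λ : Finset ℤ) : Continuous (wholeLineDensity φ Λ) := by
  have : TendstoUniformly (fun p σ => windowDensity φ p Λ σ) (wholeLineDensity φ Λ) atTop := by
    refine Metric.tendstoUniformly_iff.2 fun ε hε => ?_
    obtain ⟨N, hN⟩ := windowDensity_uniform hext Λ (half_pos hε)
    filter_upwards [eventually_ge_atTop N] with p hp σ
    rw [dist_comm, Real.dist_eq]
    exact (hN p hp σ).trans_lt (half_lt_self hε)
  exact this.continuous (Frequently.of_forall fun p => continuous_windowDensity hφ p Λ)

variable [MeasurableSpace E]

lemma isWholeLineSpecification_wholeLineDensity [Nonempty E] [DiscreteTopology E]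
    [BorelSpace E] {φ : (ℕ → E) → ℝ}
    (hφ : Continuous φ) (hext : Extensible φ) :
    IsWholeLineSpecification φ (wholeLineDensity φ) where
  isSpecification := boltzmann_isSpecification (isCocycle_energyLimit hext) fun Λ =>
    (continuous_wholeLineDensity hφ hext Λ).measurable
  translationInvariant := wholeLineDensity_translationInvariant hext
  quasilocal Λ ξ := (continuous_wholeLineDensity hφ hext Λ).comp (continuous_glue Λ ξ)
  nonNull Λ := by
    -- A positive continuous function on a compact space attains a positive minimum.
    obtain ⟨σ, -, hσ⟩ := isCompact_univ.exists_isMinOn Set.univ_nonempty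
      (continuous_wholeLineDensity hφ hext Λ).continuousOn
    exact ⟨_, boltzmann_pos (energyLimit_self φ) Λ σ, fun ξ η => hσ (Set.mem_univ _)⟩
  singleSite := tendsto_singleSiteApprox hext

lemma IsWholeLineSpecification.unique {φ : (ℕ → E) → ℝ} {γ γ' : DensityFamily ℤ E}
    (h : IsWholeLineSpecification φ γ) (h' : IsWholeLineSpecification φ γ') : γ' = γ :=
  h.isSpecification.eq_of_singleton_eq h'.isSpecification h.nonNull.pos
    fun i σ => tendsto_nhds_unique (h'.singleSite i σ) (h.singleSite i σ)

end WholeLine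

/-! ### Reduction of the DLR equations to continuous test functions -/

section Act

variable {L E : Type*} [DecidableEq L] [Fintype E]

lemma continuous_act [TopologicalSpace E] {γ : DensityFamily L E} {Λ : Finset L}
    (hγ : Continuous (γ Λ)) {f : (L → E) → ℝ} (hf : Continuous f) : Continuous (act γ Λ f) :=
  continuous_finsetSum _ fun ξ _ =>
    (hγ.comp (continuous_glue Λ ξ)).mul (hf.comp (continuous_glue Λ ξ))

variable [TopologicalSpace E] [DiscreteTopology E] [MeasurableSpace E] [BorelSpace E]

lemma _root_.Continuous.integrable_of_compactSpace {X : Type*} [TopologicalSpace X]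
    [CompactSpace X] [MeasurableSpace X] [OpensMeasurableSpace X] (μ : Measure X)
    [IsFiniteMeasure μ] {f : X → ℝ} (hf : Continuous f) : Integrable f μ :=
  (BoundedContinuousFunction.mkOfCompact ⟨f, hf⟩).integrable μ

variable [Countable L]

/-- For continuous positive densities, it is enough to test the DLR equations on continuous
functions. -/
lemma isGibbs_of_continuous {γ : DensityFamily L E} (hc : ∀ Λ, Continuous (γ Λ))
    (h0 : ∀ Λ σ, 0 ≤ γ Λ σ) (μ : Measure (L → E)) [IsProbabilityMeasure μ]
    (h : ∀ (Λ : Finset L) (f : (L → E) → ℝ), Continuous f →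
      ∫ σ, act γ Λ f σ ∂μ = ∫ σ, f σ ∂μ) : IsGibbs γ μ := by
  intro Λ
  have hgm : ∀ ξ : Λ → E, Measurable (glue Λ ξ : (L → E) → L → E) := fun ξ =>
    (continuous_glue Λ ξ).measurable
  let w : (Λ → E) → (L → E) → NNReal := fun ξ η => (γ Λ (glue Λ ξ η)).toNNReal
  have hwc : ∀ ξ, Continuous (w ξ) := fun ξ =>
    continuous_real_toNNReal.comp ((hc Λ).comp (continuous_glue Λ ξ))
  have hw : ∀ ξ η, ((w ξ η : NNReal) : ℝ) = γ Λ (glue Λ ξ η) := fun ξ η =>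
    Real.coe_toNNReal _ (h0 Λ _)
  -- The sum of these measures is `μ` transported by the kernel `γ_Λ`. It agrees with `μ` on
  -- continuous functions, hence equals `μ`, which gives the DLR equation for every integrable
  -- function.
  let κ : (Λ → E) → Measure (L → E) := fun ξ =>
    (μ.withDensity fun η => (w ξ η : ENNReal)).map (glue Λ ξ)
  have hfin : ∀ ξ, IsFiniteMeasure (μ.withDensity fun η => (w ξ η : ENNReal)) := by
    intro ξ
    have hb := (BoundedContinuousFunction.mkOfCompact ⟨_, NNReal.continuous_coe.comp
      (hwc ξ)⟩).lintegral_of_real_lt_top μ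
    refine isFiniteMeasure_withDensity ?_
    simpa using hb.ne
  have hint : ∀ (f : (L → E) → ℝ), (∀ ξ, Integrable f (κ ξ)) →
      Integrable (act γ Λ f) μ ∧ ∫ σ, act γ Λ f σ ∂μ = ∫ σ, f σ ∂(∑ ξ, κ ξ) := by
    intro f hf
    have h1 : ∀ ξ, Integrable (fun η => γ Λ (glue Λ ξ η) * f (glue Λ ξ η)) μ := by
      intro ξ
      have := (integrable_map_measure (hf ξ).aestronglyMeasurable (hgm ξ).aemeasurable).1 (hf ξ)
      rw [integrable_withDensity_iff_integrable_smul (hwc ξ).measurable] at this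
      simpa only [NNReal.smul_def, hw, smul_eq_mul, Function.comp_apply] using this
    refine ⟨integrable_finsetSum _ fun ξ _ => h1 ξ, ?_⟩
    rw [integral_finsetSum_measure fun ξ _ => hf ξ]
    simp only [act]
    rw [integral_finsetSum _ fun ξ _ => h1 ξ]
    refine Finset.sum_congr rfl fun ξ _ => ?_
    rw [integral_map (hgm ξ).aemeasurable (hf ξ).aestronglyMeasurable,
      integral_withDensity_eq_integral_smul (hwc ξ).measurable]
    simp only [NNReal.smul_def, hw, smul_eq_mul]
  have hκ : ∑ ξ, κ ξ = μ := by
    refine ext_of_forall_integral_eq_of_IsFiniteMeasure fun f => ?_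
    rw [← h Λ f f.continuous]
    exact (hint f fun ξ => f.integrable _).2.symm
  intro f hf
  rw [← hκ, integrable_finsetSum_measure] at hf
  have := hint f fun ξ => hf ξ (Finset.mem_univ ξ)
  rwa [hκ] at this

end Act

/-! ### Limit points of the averaged shifts -/

section Limit

variable {E : Type*}

lemma joinLines_natCast (u : {j : ℤ // j < 0} → E) (x : ℕ → E) (n : ℕ) :
    joinLines (u, x) n = x n := by
  simp [joinLines]

lemma energyDiff_joinLines (φ : (ℕ → E) → ℝ) (u : {j : ℤ // j < 0} → E) (x y : ℕ → E) (n : ℕ) :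
    energyDiff φ 0 n (joinLines (u, x)) (joinLines (u, y)) =
      ergodicSum φ (n + 1) y - ergodicSum φ (n + 1) x := by
  have ht : ∀ z : ℕ → E, tail 0 (joinLines (u, z)) = z := fun z => by
    funext k
    rw [tail, zero_add, joinLines_natCast]
  have := ergodicSum_sub φ n 0 (joinLines (u, x)) (joinLines (u, y))
  rw [ht, ht, zero_add] at this
  exact this.symm

/-- Seen from the site `i`, the window `[-i, i]` covers all sites of the half line that matter for
volumes near `i`. -/
lemma act_windowDensity_joinLines [Fintype E] (φ : (ℕ → E) → ℝ) (i : ℕ) (Λ : Finset ℕ)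
    (hΛ : ∀ l ∈ Λ, l ≤ 2 * i) (f : (ℤ → E) → ℝ) (u : {j : ℤ // j < 0} → E) (x : ℕ → E) :
    act (windowDensity φ i) (Λ.image fun l : ℕ => (l : ℤ) - i) f
        (shift (i : ℤ) (joinLines (u, x))) =
      act (halfLineDensity φ) Λ (fun y => f (shift (i : ℤ) (joinLines (u, y)))) x := by
  have he : Function.Injective fun l : ℕ => (l : ℤ) - i := fun a b h => by
    simpa using h
  have hglue : ∀ (ξ : ↥(Λ.image fun l : ℕ => (l : ℤ) - i) → E) (y : ℕ → E),
      glue _ ξ (shift (i : ℤ) (joinLines (u, y))) = shift (i : ℤ) (joinLines (u,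
        glue Λ (fun l => ξ ⟨(l : ℤ) - i, Finset.mem_image_of_mem _ l.2⟩) y)) := by
    intro ξ y
    funext j
    by_cases hj : j + i < 0
    · have hn : j ∉ Λ.image fun l : ℕ => (l : ℤ) - i := by
        intro hm
        obtain ⟨l, -, rfl⟩ := Finset.mem_image.1 hm
        omega
      rw [glue_of_notMem _ _ hn]
      simp [shift, joinLines, hj]
    · obtain ⟨l, rfl⟩ : ∃ l : ℕ, j = (l : ℤ) - i := ⟨(j + i).toNat, by omega⟩
      have hc := congrFun (glue_image_comp he Λ ξ (shift (i : ℤ) (joinLines (u, y)))) l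
      have hs : ∀ z : ℕ → E, (fun l : ℕ => shift (i : ℤ) (joinLines (u, z)) ((l : ℤ) - i)) = z :=
        fun z => by
          funext k
          rw [shift, sub_add_cancel, joinLines_natCast]
      rw [hs] at hc
      refine hc.trans ?_
      exact (congrFun (hs _) l).symm
  have hdens : ∀ y : ℕ → E, windowDensity φ i (Λ.image fun l : ℕ => (l : ℤ) - i)
      (shift (i : ℤ) (joinLines (u, y))) = halfLineDensity φ Λ y := by
    intro y
    simp only [windowDensity, boltzmann, halfLineDensity, hglue]
    rw [sum_image_reindex he Λ fun ξ => Real.exp (windowEnergy φ i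
      (shift (i : ℤ) (joinLines (u, y))) (shift (i : ℤ) (joinLines (u, glue Λ ξ y))))]
    have hen : ∀ ξ : Λ → E, windowEnergy φ i (shift (i : ℤ) (joinLines (u, y)))
        (shift (i : ℤ) (joinLines (u, glue Λ ξ y))) =
          ergodicSum φ (Λ.sup id + 1) (glue Λ ξ y) - ergodicSum φ (Λ.sup id + 1) y := by
      intro ξ
      have hsup : Λ.sup id ≤ 2 * i := Finset.sup_le hΛ
      rw [windowEnergy, energyDiff_shift, neg_add_cancel, energyDiff_eq_of_le φ 0
        (show ((Λ.sup id : ℕ) : ℤ) ≤ (i : ℤ) + i by omega), energyDiff_joinLines]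
      intro j hj
      obtain ⟨l, rfl⟩ : ∃ l : ℕ, j = l := ⟨j.toNat, by omega⟩
      rw [joinLines_natCast, joinLines_natCast, glue_of_notMem]
      intro hl
      have : l ≤ Λ.sup id := Finset.le_sup (f := id) hl
      omega
    simp only [hen, Real.exp_sub, ← Finset.sum_div, inv_div]
  simp only [act, hglue, hdens]
  exact sum_image_reindex he Λ fun ξ => halfLineDensity φ Λ (glue Λ ξ x) *
    f (shift (i : ℤ) (joinLines (u, glue Λ ξ x)))


variable [Fintype E] [TopologicalSpace E] [DiscreteTopology E] [MeasurableSpace E]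
  [BorelSpace E]

lemma integral_cesaroAverage (μ₀ : Measure (ℤ → E)) [IsProbabilityMeasure μ₀]
    {g : (ℤ → E) → ℝ} (hg : Continuous g) (n : ℕ) :
    ∫ σ, g σ ∂(cesaroAverage μ₀ n : Measure (ℤ → E)) =
      ((n + 1 : ℕ) : ℝ)⁻¹ * ∑ i ∈ Finset.range (n + 1), ∫ σ, g (shift (i : ℤ) σ) ∂μ₀ := by
  have hp : ∀ i : ℕ, IsProbabilityMeasure (μ₀.map (shift (i : ℤ))) := fun i =>
    Measure.isProbabilityMeasure_map (measurable_shift _).aemeasurable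
  change ∫ σ, g σ ∂(((n + 1 : ℕ) : ENNReal)⁻¹ •
    ∑ i ∈ Finset.range (n + 1), μ₀.map (shift (i : ℤ))) = _
  rw [integral_smul_measure, integral_finsetSum_measure fun i _ =>
    hg.integrable_of_compactSpace _]
  simp only [ENNReal.toReal_inv, ENNReal.toReal_natCast, smul_eq_mul]
  congr 1
  exact Finset.sum_congr rfl fun i _ =>
    integral_map (measurable_shift _).aemeasurable hg.aestronglyMeasurable

/-- Integration of a continuous function is weakly continuous, so the integral against `μ` is a
cluster point of a convergent real sequence. -/
lemma integral_eq_of_mapClusterPt {μ : ProbabilityMeasure (ℤ → E)}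
    {m : ℕ → ProbabilityMeasure (ℤ → E)} (hμ : MapClusterPt μ atTop m) {g : (ℤ → E) → ℝ}
    (hg : Continuous g) {c : ℝ}
    (h : Tendsto (fun n => ∫ σ, g σ ∂(m n : Measure (ℤ → E))) atTop (𝓝 c)) :
    ∫ σ, g σ ∂(μ : Measure (ℤ → E)) = c := by
  have h1 := hμ.continuousAt_comp
    (ProbabilityMeasure.continuous_integral_boundedContinuousFunction
      (BoundedContinuousFunction.mkOfCompact ⟨g, hg⟩)).continuousAt
  exact eq_of_nhds_neBot (h1.neBot.mono (inf_le_inf le_rfl h))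

lemma measurePreserving_shift_of_mapClusterPt (μ₀ : Measure (ℤ → E)) [IsProbabilityMeasure μ₀]
    {μ : ProbabilityMeasure (ℤ → E)} (hμ : MapClusterPt μ atTop fun n => cesaroAverage μ₀ n) :
    MeasurePreserving (shift 1) (μ : Measure (ℤ → E)) (μ : Measure (ℤ → E)) := by
  refine ⟨measurable_shift 1, ?_⟩
  have := Measure.isProbabilityMeasure_map (μ := (μ : Measure (ℤ → E)))
    (measurable_shift (E := E) 1).aemeasurable
  refine ext_of_forall_integral_eq_of_IsFiniteMeasure fun f => ?_
  rw [integral_map (measurable_shift 1).aemeasurable f.continuous.aestronglyMeasurable]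
  have hc : Continuous fun σ : ℤ → E => f (shift 1 σ) := f.continuous.comp (continuous_shift 1)
  rw [← sub_eq_zero, ← integral_sub (hc.integrable_of_compactSpace _) (f.integrable _)]
  refine integral_eq_of_mapClusterPt hμ (hc.sub f.continuous) ?_
  simp only [integral_cesaroAverage μ₀ (hc.sub f.continuous)]
  have hi : ∀ i : ℤ, Integrable (fun σ => f (shift i σ)) μ₀ := fun i =>
    (f.continuous.comp (continuous_shift i)).integrable_of_compactSpace _
  -- The sum telescopes to two boundary terms, each bounded by `‖f‖`, which the factor `1/(n+1)`
  -- kills.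
  have hs : ∀ n : ℕ, ∑ i ∈ Finset.range (n + 1),
      ∫ σ, (f (shift 1 (shift (i : ℤ) σ)) - f (shift (i : ℤ) σ)) ∂μ₀ =
        ∫ σ, f (shift ((n + 1 : ℕ) : ℤ) σ) ∂μ₀ - ∫ σ, f (shift ((0 : ℕ) : ℤ) σ) ∂μ₀ := by
    intro n
    rw [← Finset.sum_range_sub fun i : ℕ => ∫ σ, f (shift (i : ℤ) σ) ∂μ₀]
    refine Finset.sum_congr rfl fun i _ => ?_
    have hsh : ∀ σ : ℤ → E, shift 1 (shift (i : ℤ) σ) = shift ((i + 1 : ℕ) : ℤ) σ := by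
      intro σ
      funext j
      simp only [shift]
      congr 1
      push_cast
      ring
    simp only [hsh]
    exact integral_sub (hi _) (hi _)
  have hb : ∀ i : ℤ, |∫ σ, f (shift i σ) ∂μ₀| ≤ ‖f‖ := fun i => by
    have := norm_integral_le_of_norm_le_const (μ := μ₀) (f := fun σ => f (shift i σ))
      (ae_of_all _ fun σ => f.norm_coe_le_norm _)
    simpa using this
  have h0 : Tendsto (fun n : ℕ => ((n + 1 : ℕ) : ℝ)⁻¹) atTop (𝓝 0) :=
    (tendsto_inv_atTop_zero.comp tendsto_natCast_atTop_atTop).comp (tendsto_add_atTop_nat 1)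
  refine h0.zero_mul_isBoundedUnder_le (isBoundedUnder_of ⟨‖f‖ + ‖f‖, fun n => ?_⟩)
  simp only [Function.comp_apply, Pi.sub_apply, hs, Real.norm_eq_abs]
  exact (abs_sub _ _).trans (add_le_add (hb _) (hb _))

variable [Nonempty E]

/-- By Fubini, fix the left half `u` and apply the DLR equation of `ν` in the volume `Λ + i`, which
lies in `[0, 2i]`. The law of the left half enters only through the product structure. -/
lemma integral_act_windowDensity {φ : (ℕ → E) → ℝ} (hφ : Continuous φ) {ν : Measure (ℕ → E)}
    [IsProbabilityMeasure ν] (hν : IsGibbs (halfLineDensity φ) ν) (Λ : Finset ℤ) {i : ℕ}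
    (hΛ : ∀ l ∈ Λ, -(i : ℤ) ≤ l ∧ l ≤ i) {f : (ℤ → E) → ℝ} (hf : Continuous f) :
    ∫ σ, act (windowDensity φ i) Λ f (shift (i : ℤ) σ) ∂(initialMeasure ν) =
      ∫ σ, f (shift (i : ℤ) σ) ∂(initialMeasure ν) := by
  obtain ⟨Λ', hΛ', rfl⟩ : ∃ Λ' : Finset ℕ, (∀ l ∈ Λ', l ≤ 2 * i) ∧
      (Λ'.image fun l : ℕ => (l : ℤ) - i) = Λ := by
    refine ⟨Λ.image fun l : ℤ => (l + i).toNat, fun l hl => ?_, ?_⟩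
    · obtain ⟨k, hk, rfl⟩ := Finset.mem_image.1 hl
      have := hΛ k hk
      omega
    · rw [Finset.image_image]
      refine (Finset.image_congr fun l hl => ?_).trans Finset.image_id
      have := hΛ l hl
      simp only [Function.comp_apply, id_eq]
      omega
  have hca : Continuous fun σ : ℤ → E =>
      act (windowDensity φ i) (Λ'.image fun l : ℕ => (l : ℤ) - i) f (shift (i : ℤ) σ) :=
    (continuous_act (continuous_windowDensity hφ i _) hf).comp (continuous_shift _)
  have hcf : Continuous fun σ : ℤ → E => f (shift (i : ℤ) σ) := hf.comp (continuous_shift _)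
  have hint : ∀ g : (ℤ → E) → ℝ, Continuous g →
      Integrable (fun q => g (joinLines q)) ((uniformBernoulli E).prod ν) := fun g hg =>
    (integrable_map_measure hg.aestronglyMeasurable measurable_joinLines.aemeasurable).1
      (hg.integrable_of_compactSpace (initialMeasure ν))
  rw [initialMeasure, integral_map measurable_joinLines.aemeasurable hca.aestronglyMeasurable,
    integral_map measurable_joinLines.aemeasurable hcf.aestronglyMeasurable,
    integral_prod _ (hint _ hca), integral_prod _ (hint _ hcf)]
  refine integral_congr_ae ?_
  -- Integrability of the slice at `u` is what the DLR equation of `ν` requires.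
  filter_upwards [(hint _ hcf).prod_right_ae] with u hu
  simp only [act_windowDensity_joinLines φ i Λ' hΛ']
  exact (hν Λ' _ hu).2

lemma tendsto_integral_act_sub {φ : (ℕ → E) → ℝ} (hφ : Continuous φ) (hext : Extensible φ)
    {ν : Measure (ℕ → E)} [IsProbabilityMeasure ν] (hν : IsGibbs (halfLineDensity φ) ν)
    (Λ : Finset ℤ) {f : (ℤ → E) → ℝ} (hf : Continuous f) :
    Tendsto (fun i : ℕ => ∫ σ, (act (wholeLineDensity φ) Λ f (shift (i : ℤ) σ) -
      f (shift (i : ℤ) σ)) ∂(initialMeasure ν)) atTop (𝓝 0) := by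
  obtain ⟨C, hC⟩ : ∃ C : ℝ, ∀ σ, |f σ| ≤ C :=
    ⟨_, (BoundedContinuousFunction.mkOfCompact ⟨f, hf⟩).norm_coe_le_norm⟩
  have hC0 : 0 ≤ C := (abs_nonneg _).trans (hC fun _ => Classical.arbitrary E)
  set c : ℝ := Fintype.card (Λ → E) * C with hc
  have hc0 : 0 ≤ c := by positivity
  obtain ⟨K, hK⟩ : ∃ K : ℕ, ∀ l ∈ Λ, l.natAbs ≤ K :=
    ⟨Λ.sup Int.natAbs, fun l hl => Finset.le_sup (f := Int.natAbs) hl⟩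
  refine Metric.tendsto_atTop.2 fun ε hε => ?_
  -- Each of the `|E^Λ|` terms costs at most `δ C`, in total `δ c`; `c + 1` guards against `c = 0`.
  have hδ : 0 < ε / (2 * (c + 1)) := by positivity
  obtain ⟨N, hN⟩ := windowDensity_uniform hext Λ hδ
  refine ⟨max N K, fun i hi => ?_⟩
  have hcw : Continuous fun σ : ℤ → E => act (wholeLineDensity φ) Λ f (shift (i : ℤ) σ) :=
    (continuous_act (continuous_wholeLineDensity hφ hext Λ) hf).comp (continuous_shift _)
  have hca : Continuous fun σ : ℤ → E => act (windowDensity φ i) Λ f (shift (i : ℤ) σ) :=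
    (continuous_act (continuous_windowDensity hφ i Λ) hf).comp (continuous_shift _)
  have hcf : Continuous fun σ : ℤ → E => f (shift (i : ℤ) σ) := hf.comp (continuous_shift _)
  rw [integral_sub (hcw.integrable_of_compactSpace _) (hcf.integrable_of_compactSpace _),
    ← integral_act_windowDensity hφ hν Λ (fun l hl => by have := hK l hl; omega) hf,
    ← integral_sub (hcw.integrable_of_compactSpace _) (hca.integrable_of_compactSpace _),
    dist_zero_right]
  have hb : ∀ σ : ℤ → E, ‖act (wholeLineDensity φ) Λ f σ - act (windowDensity φ i) Λ f σ‖ ≤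
      ε / (2 * (c + 1)) * c := by
    intro σ
    rw [act, act, ← Finset.sum_sub_distrib]
    refine (norm_sum_le_of_le (n := fun _ => ε / (2 * (c + 1)) * C) _ fun ξ _ => ?_).trans ?_
    · rw [← sub_mul, norm_mul, norm_sub_rev]
      exact mul_le_mul (hN i (le_of_max_le_left hi) _) (hC _) (norm_nonneg _) hδ.le
    · rw [Finset.sum_const, Finset.card_univ, nsmul_eq_mul, hc]
      exact le_of_eq (by ring)
  have := norm_integral_le_of_norm_le_const (μ := initialMeasure ν)
    (ae_of_all _ fun σ => hb (shift (i : ℤ) σ))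
  refine this.trans_lt ?_
  rw [probReal_univ, mul_one, div_mul_eq_mul_div, div_lt_iff₀ (by positivity)]
  nlinarith

lemma isGibbs_of_mapClusterPt {φ : (ℕ → E) → ℝ} (hφ : Continuous φ) (hext : Extensible φ)
    {ν : Measure (ℕ → E)} [IsProbabilityMeasure ν] (hν : IsGibbs (halfLineDensity φ) ν)
    {μ : ProbabilityMeasure (ℤ → E)}
    (hμ : MapClusterPt μ atTop fun n => cesaroAverage (initialMeasure ν) n) :
    IsGibbs (wholeLineDensity φ) (μ : Measure (ℤ → E)) := by
  refine isGibbs_of_continuous (continuous_wholeLineDensity hφ hext)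
    (fun Λ σ => (boltzmann_pos (energyLimit_self φ) Λ σ).le) _ fun Λ f hf => ?_
  have hca : Continuous (act (wholeLineDensity φ) Λ f) :=
    continuous_act (continuous_wholeLineDensity hφ hext Λ) hf
  rw [← sub_eq_zero, ← integral_sub (hca.integrable_of_compactSpace _)
    (hf.integrable_of_compactSpace _)]
  refine integral_eq_of_mapClusterPt hμ (hca.sub hf) ?_
  simp only [integral_cesaroAverage _ (hca.sub hf)]
  -- Cesàro means of a null sequence are null; the index moves by one because the `n`-th average has
  -- `n + 1` terms.
  exact (tendsto_integral_act_sub hφ hext hν Λ hf).cesaro.comp (tendsto_add_atTop_nat 1)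

end Limit

end

end HalfLine

theorem theoremB {E : Type*} [Fintype E] [Nonempty E] [TopologicalSpace E] [DiscreteTopology E]
    [MeasurableSpace E] [BorelSpace E]
    (φ : (ℕ → E) → ℝ) (hφ : Continuous φ) (hext : HalfLine.Extensible φ)
    (ν : Measure (ℕ → E)) [IsProbabilityMeasure ν]
    (hν : HalfLine.IsGibbs (HalfLine.halfLineDensity φ) ν)
    (μ : ProbabilityMeasure (ℤ → E))
    (hμ : MapClusterPt μ atTop
      (fun n : ℕ => HalfLine.cesaroAverage (HalfLine.initialMeasure ν) n)) :
    ∃ γ : HalfLine.DensityFamily ℤ E,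
      HalfLine.IsWholeLineSpecification φ γ ∧
      (∀ γ' : HalfLine.DensityFamily ℤ E, HalfLine.IsWholeLineSpecification φ γ' → γ' = γ) ∧
      HalfLine.IsGibbs γ (μ : Measure (ℤ → E)) ∧
      MeasurePreserving (HalfLine.shift 1) (μ : Measure (ℤ → E)) (μ : Measure (ℤ → E)) := by
  have hγ := HalfLine.isWholeLineSpecification_wholeLineDensity hφ hext
  exact ⟨HalfLine.wholeLineDensity φ, hγ, fun _ hγ' => hγ.unique hγ',
    HalfLine.isGibbs_of_mapClusterPt hφ hext hν hμ,
    HalfLine.measurePreserving_shift_of_mapClusterPt _ hμ⟩
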